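/- **Conventions.** $K$ is a field. A directed graph is $E=(E^0,E^1,r,s)$; it is row-finite if $s^{-1}(v)$ is finite for every $v\in E^0$. A vertex $v$ is regular if $s^{-1}(v)$ is finite and nonempty. For $u,v\in E^0$ write $u\ge v$ if there is a (possibly trivial) path from $u$ to $v$, and for $A\subseteq E^0$ write $u\ge A$ if $u\ge v$ for some $v\in A$. A set $A\subseteq E^0$ is hereditary if $v\in A$, $v\ge w$ imply $w\in A$, and saturated if $r(s^{-1}(v))\subseteq A$ implies $v\in A$ for every regular $v$. The sets $A$ with $A=\{v: v\ge A\}$ are the closed sets of a topology on $E^0$; $\mathrm{ext}(A)$ is the complement of the closure of $A$ in it, that is, $\mathrm{ext}(A)=\{v\in E^0: v\not\ge A\}$. Let $\mathcal{Grph}$ be the category of directed graphs and graph isomorphisms. A point functor $H$ is a subfunctor of $E\mapsto E^0$, $\mathcal{Grph}\to\mathcal{Set}$; it is hereditary (saturated) if $H(E)$ is so for every $E$, and $\mathrm{ext}(H)$ is the point functor $E\mapsto\mathrm{ext}(H(E))$. $L_K(E)$ is the Leavitt path algebra, $I(A)$ is the two-sided ideal of $L_K(E)$ generated by $A\subseteq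 E^0$, and $\mathrm{Ann}(I)=\{a: aI=Ia=0\}$. Given a ring isomorphism $f\colon L_K(E)\to L_K(F)$, $H_1$ is $f$-related to $H_2$ if $f(I(H_1(E)))=I(H_2(F))$, and $H$ is $f$-invariant if it is $f$-related to itself. **Proposition.** Let $H$ be a hereditary and saturated point functor. Then: 1. $\mathrm{ext}(H)$ is a hereditary and saturated point functor. 2. $\mathrm{Ann}(I(H(E)))=I(\mathrm{ext}(H)(E))$ for every row-finite graph $E$. 3. $\mathrm{ext}(\mathrm{ext}(H))$ is a hereditary and saturated point functor, and $\mathrm{Ann}(\mathrm{Ann}(I(H(E))))=I(\mathrm{ext}(\mathrm{ext}(H))(E))$ for every row-finite graph $E$. 4. $\mathrm{ext}(\mathrm{ext}(H))(E)\subseteq\{v\in E^0: v\ge H(E)\}$ for every graph $E$. 5. $H(E)\subseteq\mathrm{ext}(\mathrm{ext}(H))(E)$ for every graph $E$. 6. For every graph $E$: $\mathrm{ext}(\mathrm{ext}(H))(E)\subseteq H(E)$ if and only if every $v\in E^0$ such that $v\not\ge w$ for all $w\not\ge H(E)$ belongs to $H(E)$. Moreover: 7. Let $E,F$ be row-finite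 graphs, $f\colon L_K(E)\to L_K(F)$ a ring isomorphism, and $H_1,H_2$ hereditary point functors. If $H_1$ is $f$-related to $H_2$, then $\mathrm{ext}(H_1)$ is $f$-related to $\mathrm{ext}(H_2)$. In particular, if a hereditary point functor $H$ is $f$-invariant, then so is $\mathrm{ext}(H)$. -/

import Mathlib

open CategoryTheory

universe u v w

/-- A directed graph `E = (E⁰, E¹, r, s)`. -/
structure DirectedGraph where
  /-- the vertices -/
  V : Type u
  /-- the edges -/
  Edge : Type v
  /-- the source map -/
  s : Edge → V
  /-- the range map -/
  r : Edge → V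

namespace DirectedGraph

section Graph

variable (E : DirectedGraph.{u, v})

/-- Every vertex emits only finitely many edges. -/
def RowFinite : Prop := ∀ x : E.V, {e : E.Edge | E.s e = x}.Finite

/-- A regular vertex: neither a sink nor an infinite emitter. -/
def IsRegular (x : E.V) : Prop :=
  {e : E.Edge | E.s e = x}.Nonempty ∧ {e : E.Edge | E.s e = x}.Finite

/-- `x ≥ y`: there is a (possibly trivial) path from `x` to `y`. -/
def Connects (x y : E.V) : Prop :=
  Relation.ReflTransGen (fun a b => ∃ e : E.Edge, E.s e = a ∧ E.r e = b) x y

/-- `x ≥ A`: there is a path from `x` to some vertex in `A`. -/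
def ConnectsTo (x : E.V) (A : Set E.V) : Prop := ∃ y ∈ A, E.Connects x y

/-- Hereditary sets of vertices. -/
def IsHereditary (A : Set E.V) : Prop := ∀ x ∈ A, ∀ y, E.Connects x y → y ∈ A

/-- Saturated sets of vertices. -/
def IsSaturated (A : Set E.V) : Prop :=
  ∀ x, E.IsRegular x → (∀ e : E.Edge, E.s e = x → E.r e ∈ A) → x ∈ A

/-- The Kuratowski closure operator `c(A) = {x | x ≥ A}`. -/
def dcClosure (A : Set E.V) : Set E.V := {x | E.ConnectsTo x A}

theorem subset_dcClosure (A : Set E.V) : A ⊆ E.dcClosure A :=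
  fun x hx => ⟨x, hx, Relation.ReflTransGen.refl⟩

/-- The directed connection closure topology on the vertices: the closed sets are the sets `A`
with `A = c(A)`. -/
abbrev dcTopology : TopologicalSpace E.V :=
  TopologicalSpace.ofClosed {A : Set E.V | A = E.dcClosure A}
    (by
      ext x
      constructor
      · intro h
        exact h.elim
      · rintro ⟨y, hy, -⟩
        exact hy)
    (by
      intro S hS
      refine Set.Subset.antisymm (E.subset_dcClosure _) ?_
      rintro x ⟨y, hy, hxy⟩ A hA
      have h := hS hA
      rw [Set.mem_ofPred_eq] at h
      rw [h]
      exact ⟨y, hy A hA, hxy⟩)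
    (by
      intro A hA B hB
      rw [Set.mem_ofPred_eq] at hA hB
      refine Set.Subset.antisymm (E.subset_dcClosure _) ?_
      rintro x ⟨y, hy | hy, hxy⟩
      · left
        rw [hA]
        exact ⟨y, hy, hxy⟩
      · right
        rw [hB]
        exact ⟨y, hy, hxy⟩)

/-- The exterior of `A` in the directed connection closure topology: the complement of the
topological closure of `A`. -/
def exterior (A : Set E.V) : Set E.V := (@closure E.V E.dcTopology A)ᶜ

theorem closure_eq_dcClosure (A : Set E.V) :
    @closure E.V E.dcTopology A = E.dcClosure A := by
  let _ : TopologicalSpace E.V := E.dcTopology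
  have hcl : ∀ B : Set E.V, IsClosed B ↔ B = E.dcClosure B := by
    intro B
    rw [← isOpen_compl_iff]
    change Bᶜᶜ = E.dcClosure Bᶜᶜ ↔ _
    rw [compl_compl]
  apply Set.Subset.antisymm
  · refine closure_minimal (E.subset_dcClosure A) ((hcl _).2 ?_)
    refine Set.Subset.antisymm (E.subset_dcClosure _) ?_
    rintro x ⟨y, ⟨z, hz, hyz⟩, hxy⟩
    exact ⟨z, hz, Relation.ReflTransGen.trans hxy hyz⟩
  · rintro x ⟨y, hy, hxy⟩
    rw [(hcl _).1 (isClosed_closure (s := A))]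
    exact ⟨y, subset_closure hy, hxy⟩

/-- The exterior of `A` consists of the vertices that do not connect to `A`. -/
theorem mem_exterior_iff (A : Set E.V) (x : E.V) : x ∈ E.exterior A ↔ ¬ E.ConnectsTo x A := by
  rw [exterior, closure_eq_dcClosure]
  rfl

end Graph

/-! ### The category of directed graphs and graph isomorphisms, and point functors -/

/-- An isomorphism of directed graphs. -/
@[ext]
structure GraphIso (E F : DirectedGraph.{u, v}) where
  /-- the bijection on vertices -/
  vertex : E.V ≃ F.V
  /-- the bijection on edges -/
  edge : E.Edge ≃ F.Edge
  /-- compatibility with sources -/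
  map_s : ∀ e, vertex (E.s e) = F.s (edge e)
  /-- compatibility with ranges -/
  map_r : ∀ e, vertex (E.r e) = F.r (edge e)

/-- The category whose objects are the directed graphs and whose morphisms are the
isomorphisms of directed graphs. -/
instance instCategory : Category DirectedGraph.{u, v} where
  Hom E F := GraphIso E F
  id E := ⟨Equiv.refl _, Equiv.refl _, fun _ => rfl, fun _ => rfl⟩
  comp f g := ⟨f.vertex.trans g.vertex, f.edge.trans g.edge,
    fun e => by simp [f.map_s, g.map_s], fun e => by simp [f.map_r, g.map_r]⟩

/-- The functor sending a graph to its set of vertices. -/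
def vertexFunctor : DirectedGraph.{u, v} ⥤ Type u where
  obj E := E.V
  map f := TypeCat.ofHom f.vertex

/-- Point functors: subfunctors of the functor of vertices. -/
abbrev PointFunctor := Subfunctor vertexFunctor.{u, v}

theorem GraphIso.connects {E F : DirectedGraph.{u, v}} (f : GraphIso E F) {x y : E.V}
    (h : E.Connects x y) : F.Connects (f.vertex x) (f.vertex y) := by
  refine Relation.ReflTransGen.lift f.vertex ?_ _ _ h
  rintro a b ⟨e, rfl, rfl⟩
  exact ⟨f.edge e, (f.map_s e).symm, (f.map_r e).symm⟩

/-- The inverse of an isomorphism of directed graphs. -/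
def GraphIso.symm {E F : DirectedGraph.{u, v}} (f : GraphIso E F) : GraphIso F E where
  vertex := f.vertex.symm
  edge := f.edge.symm
  map_s e := by rw [Equiv.symm_apply_eq, f.map_s, Equiv.apply_symm_apply]
  map_r e := by rw [Equiv.symm_apply_eq, f.map_r, Equiv.apply_symm_apply]

namespace PointFunctor

/-- The subset of vertices of `E` given by the point functor `H`. -/
def points (H : PointFunctor.{u, v}) (E : DirectedGraph.{u, v}) : Set E.V := H.obj E

/-- `H(E)` is hereditary for every graph `E`. -/
def Hereditary (H : PointFunctor.{u, v}) : Prop := ∀ E : DirectedGraph.{u, v}, E.IsHereditary (points H E)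

/-- `H(E)` is saturated for every graph `E`. -/
def Saturated (H : PointFunctor.{u, v}) : Prop := ∀ E : DirectedGraph.{u, v}, E.IsSaturated (points H E)

/-- The exterior point functor: `ext(H)(E) = ext(H(E))`. -/
def exterior (H : PointFunctor.{u, v}) : PointFunctor.{u, v} where
  obj E := E.exterior (points H E)
  map {E F} i := by
    intro x hx
    change E.V at x
    change i.vertex x ∈ F.exterior (points H F)
    refine (F.mem_exterior_iff _ _).2 ?_
    rintro ⟨y, hy, hxy⟩
    refine (E.mem_exterior_iff _ _).1 hx ?_
    refine ⟨(GraphIso.symm i).vertex y, H.map (GraphIso.symm i : F ⟶ E) hy, ?_⟩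
    have h := (GraphIso.symm i).connects hxy
    rwa [show (GraphIso.symm i).vertex (i.vertex x) = x from i.vertex.symm_apply_apply x] at h

end PointFunctor

end DirectedGraph

/-! ### Leavitt path algebras -/

/-- The generators of a Leavitt path algebra: vertices, edges and ghost edges. -/
inductive LeavittGen (E : DirectedGraph.{u, v}) : Type (max u v)
  | vertex : E.V → LeavittGen E
  | edge : E.Edge → LeavittGen E
  | ghost : E.Edge → LeavittGen E

/-- The free (non-unital, associative) `K`-algebra on the vertices, edges and ghost edges. -/
abbrev LeavittFree (K : Type w) [Field K] (E : DirectedGraph.{u, v}) : Type (max u v w) :=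
  MonoidAlgebra K (FreeSemigroup (LeavittGen E))

namespace LeavittFree

variable (K : Type w) [Field K] {E : DirectedGraph.{u, v}}

/-- A generator as an element of the free algebra. -/
noncomputable def gen (x : LeavittGen E) : LeavittFree K E :=
  MonoidAlgebra.single (FreeSemigroup.of x) 1

/-- The generator of a vertex. -/
noncomputable def vtx (x : E.V) : LeavittFree K E := gen K (.vertex x)

/-- The generator of an edge `e`. -/
noncomputable def edg (e : E.Edge) : LeavittFree K E := gen K (.edge e)

/-- The generator of a ghost edge `e*`. -/
noncomputable def gst (e : E.Edge) : LeavittFree K E := gen K (.ghost e)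

end LeavittFree

open LeavittFree in
/-- The defining relations of the Leavitt path algebra. The constructor `smul` makes the
generated ring congruence a congruence of `K`-algebras. -/
inductive LeavittRel (K : Type w) [Field K] (E : DirectedGraph.{u, v}) :
    LeavittFree K E → LeavittFree K E → Prop
  | vertex_idem (x : E.V) : LeavittRel K E (vtx K x * vtx K x) (vtx K x)
  | vertex_orth (x y : E.V) (h : x ≠ y) : LeavittRel K E (vtx K x * vtx K y) 0
  | source_edge (e : E.Edge) : LeavittRel K E (vtx K (E.s e) * edg K e) (edg K e)
  | edge_range (e : E.Edge) : LeavittRel K E (edg K e * vtx K (E.r e)) (edg K e)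
  | range_ghost (e : E.Edge) : LeavittRel K E (vtx K (E.r e) * gst K e) (gst K e)
  | ghost_source (e : E.Edge) : LeavittRel K E (gst K e * vtx K (E.s e)) (gst K e)
  | ck1_same (e : E.Edge) : LeavittRel K E (gst K e * edg K e) (vtx K (E.r e))
  | ck1_ne (e f : E.Edge) (h : e ≠ f) : LeavittRel K E (gst K e * edg K f) 0
  | ck2 (x : E.V) (h : E.IsRegular x) :
      LeavittRel K E (vtx K x) (∑ e ∈ h.2.toFinset, edg K e * gst K e)
  | smul (k : K) (a b : LeavittFree K E) (h : LeavittRel K E a b) :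
      LeavittRel K E (k • a) (k • b)

/-- The congruence on the free algebra generated by the Leavitt relations. -/
noncomputable def leavittCon (K : Type w) [Field K] (E : DirectedGraph.{u, v}) : RingCon (LeavittFree K E) :=
  ringConGen (LeavittRel K E)

/-- The Leavitt path algebra `L_K(E)`: the (in general non-unital) associative `K`-algebra
generated by vertices, edges and ghost edges subject to the Leavitt relations. -/
noncomputable def LeavittPathAlgebra (K : Type w) [Field K] (E : DirectedGraph.{u, v}) : Type (max u v w) :=
  (leavittCon K E).Quotient

namespace LeavittPathAlgebra

variable (K : Type w) [Field K] (E : DirectedGraph.{u, v})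

noncomputable instance : NonUnitalRing (LeavittPathAlgebra K E) :=
  inferInstanceAs (NonUnitalRing (leavittCon K E).Quotient)

theorem leavittCon_smul (k : K) {a b : LeavittFree K E} (h : leavittCon K E a b) :
    leavittCon K E (k • a) (k • b) := by
  change RingConGen.Rel (LeavittRel K E) a b at h
  change RingConGen.Rel (LeavittRel K E) (k • a) (k • b)
  induction h with
  | of x y h => exact .of _ _ (.smul k _ _ h)
  | refl x => exact .refl _
  | symm _ ih => exact ih.symm
  | trans _ _ ih₁ ih₂ => exact ih₁.trans ih₂
  | add _ _ ih₁ ih₂ =>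
    rw [smul_add, smul_add]
    exact ih₁.add ih₂
  | mul _ h₂ ih₁ _ =>
    rw [← smul_mul_assoc, ← smul_mul_assoc]
    exact ih₁.mul h₂

/-- The quotient map from the free algebra onto the Leavitt path algebra. -/
noncomputable def mk (a : LeavittFree K E) : LeavittPathAlgebra K E := (a : (leavittCon K E).Quotient)

theorem mk_surjective : Function.Surjective (mk K E) :=
  fun x => Quotient.inductionOn' x fun a => ⟨a, rfl⟩

theorem mk_add (a b : LeavittFree K E) : mk K E (a + b) = mk K E a + mk K E b := rfl

theorem mk_mul (a b : LeavittFree K E) : mk K E (a * b) = mk K E a * mk K E b := rfl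

theorem mk_zero : mk K E 0 = 0 := rfl

noncomputable instance : SMul K (LeavittPathAlgebra K E) :=
  ⟨fun k => Quotient.map' (fun a => k • a) fun _ _ h => leavittCon_smul K E k h⟩

theorem mk_smul (k : K) (a : LeavittFree K E) : mk K E (k • a) = k • mk K E a := rfl

noncomputable instance : Module K (LeavittPathAlgebra K E) where
  one_smul x := by
    obtain ⟨a, rfl⟩ := mk_surjective K E x
    rw [← mk_smul, one_smul]
  mul_smul k l x := by
    obtain ⟨a, rfl⟩ := mk_surjective K E x
    simp only [← mk_smul, mul_smul]
  smul_zero k := by rw [← mk_zero, ← mk_smul, smul_zero]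
  smul_add k x y := by
    obtain ⟨a, rfl⟩ := mk_surjective K E x
    obtain ⟨b, rfl⟩ := mk_surjective K E y
    simp only [← mk_smul, ← mk_add, smul_add]
  add_smul k l x := by
    obtain ⟨a, rfl⟩ := mk_surjective K E x
    simp only [← mk_smul, ← mk_add, add_smul]
  zero_smul x := by
    obtain ⟨a, rfl⟩ := mk_surjective K E x
    rw [← mk_smul, zero_smul, mk_zero]

instance : IsScalarTower K (LeavittPathAlgebra K E) (LeavittPathAlgebra K E) where
  smul_assoc k x y := by
    obtain ⟨a, rfl⟩ := mk_surjective K E x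
    obtain ⟨b, rfl⟩ := mk_surjective K E y
    simp only [smul_eq_mul, ← mk_smul, ← mk_mul, smul_mul_assoc]

instance : SMulCommClass K (LeavittPathAlgebra K E) (LeavittPathAlgebra K E) where
  smul_comm k x y := by
    obtain ⟨a, rfl⟩ := mk_surjective K E x
    obtain ⟨b, rfl⟩ := mk_surjective K E y
    simp only [smul_eq_mul, ← mk_smul, ← mk_mul, mul_smul_comm]

variable {E}

/-- A vertex as an element of the Leavitt path algebra. -/
noncomputable def vertex (x : E.V) : LeavittPathAlgebra K E := mk K E (LeavittFree.vtx K x)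

/-- `I(A)`: the two-sided ideal of `L_K(E)` generated by a set `A` of vertices. -/
noncomputable def vertexIdeal (A : Set E.V) : TwoSidedIdeal (LeavittPathAlgebra K E) :=
  TwoSidedIdeal.span (vertex K '' A)

end LeavittPathAlgebra

/-- The two-sided annihilator `Ann(I) = {a | aI = Ia = 0}` of a two-sided ideal. -/
def TwoSidedIdeal.Ann {R : Type*} [NonUnitalRing R] (I : TwoSidedIdeal R) : TwoSidedIdeal R :=
  TwoSidedIdeal.mk' {a | ∀ x ∈ I, a * x = 0 ∧ x * a = 0}
    (fun x _ => ⟨zero_mul x, mul_zero x⟩)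
    (fun {a b} ha hb x hx => ⟨by rw [add_mul, (ha x hx).1, (hb x hx).1, add_zero],
      by rw [mul_add, (ha x hx).2, (hb x hx).2, add_zero]⟩)
    (fun {a} ha x hx => ⟨by rw [neg_mul, (ha x hx).1, neg_zero],
      by rw [mul_neg, (ha x hx).2, neg_zero]⟩)
    (fun {a b} hb x hx => ⟨by rw [mul_assoc, (hb x hx).1, mul_zero],
      by rw [← mul_assoc, (hb _ (I.mul_mem_right x a hx)).2]⟩)
    (fun {a b} ha x hx => ⟨by rw [mul_assoc, (ha _ (I.mul_mem_left b x hx)).1],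
      by rw [← mul_assoc, (ha x hx).2, zero_mul]⟩)

theorem TwoSidedIdeal.mem_Ann {R : Type*} [NonUnitalRing R] (I : TwoSidedIdeal R) (a : R) :
    a ∈ I.Ann ↔ ∀ x ∈ I, a * x = 0 ∧ x * a = 0 := by
  rw [← SetLike.mem_coe, TwoSidedIdeal.Ann, TwoSidedIdeal.coe_mk']
  rfl

namespace DirectedGraph.PointFunctor

open LeavittPathAlgebra

/-- For a ring isomorphism `f : L_K(E) → L_K(F)`, `H₁` is `f`-related to `H₂` if
`f(I(H₁(E))) = I(H₂(F))`. -/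
def FRelated {K : Type w} [Field K] {E F : DirectedGraph.{u, v}}
    (f : LeavittPathAlgebra K E ≃+* LeavittPathAlgebra K F) (H₁ H₂ : PointFunctor.{u, v}) : Prop :=
  f '' (vertexIdeal K (points H₁ E) : Set (LeavittPathAlgebra K E)) =
    (vertexIdeal K (points H₂ F) : Set (LeavittPathAlgebra K F))

/-- `H` is `f`-invariant if it is `f`-related to itself. -/
def FInvariant {K : Type w} [Field K] {E F : DirectedGraph.{u, v}}
    (f : LeavittPathAlgebra K E ≃+* LeavittPathAlgebra K F) (H : PointFunctor.{u, v}) : Prop :=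
  FRelated f H H

end DirectedGraph.PointFunctor

/-! The core is the equality Ann(I(A)) = I(ext(A)) for hereditary A and row-finite E
(`Ann_vertexIdeal`). The remaining items are reachability arguments in the graph, together with the
fact that a ring isomorphism carries annihilators to annihilators (`TwoSidedIdeal.image_Ann`).

For the inclusion of I(ext(A)) in Ann(I(A)): a vertex x of ext(A) and a vertex y of A have no common
descendant, while the algebra is spanned by products of a path and a ghost path, so the corner
between x and y vanishes (`vertex_mul_mul_vertex_eq_zero`).

For the converse, let a annihilate I(A) and look at the corners ax, which add up to a. At a regular
x the second Cuntz-Krieger relation gives ax = ∑ (ae)e*, where each ae still annihilates I(A) and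
has smaller ghost length. This descent leaves the case where ax is a combination of paths ending in
x. If x does not connect to A, then ax lies in I(ext(A)). If a path q leads from x into A, then
(ax)q = 0 and q has to be cancelled. A representation does this: q moves some basis vector to a
basis vector over x, and distinct paths ending in x send that vector to distinct basis vectors
(`eq_zero_of_rep_eq_zero`). -/

namespace LeavittPathAlgebra

open DirectedGraph

variable (K : Type w) [Field K] {E : DirectedGraph.{u, v}}

/-! ### Generators, relations and local units -/

/-- An edge as an element of the Leavitt path algebra. -/
noncomputable def edge (e : E.Edge) : LeavittPathAlgebra K E := mk K E (LeavittFree.edg K e)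

/-- A ghost edge as an element of the Leavitt path algebra. -/
noncomputable def ghost (e : E.Edge) : LeavittPathAlgebra K E := mk K E (LeavittFree.gst K e)

variable {K} in
theorem mk_eq_of_rel {a b : LeavittFree K E} (h : LeavittRel K E a b) : mk K E a = mk K E b :=
  Quotient.sound' (RingConGen.Rel.of _ _ h)

theorem vertex_mul_self (x : E.V) : vertex K x * vertex K x = vertex K x :=
  mk_eq_of_rel (.vertex_idem x)

theorem vertex_mul_of_ne {x y : E.V} (h : x ≠ y) : vertex K x * vertex K y = 0 :=
  mk_eq_of_rel (.vertex_orth x y h)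

theorem source_mul_edge (e : E.Edge) : vertex K (E.s e) * edge K e = edge K e :=
  mk_eq_of_rel (.source_edge e)

theorem edge_mul_range (e : E.Edge) : edge K e * vertex K (E.r e) = edge K e :=
  mk_eq_of_rel (.edge_range e)

theorem range_mul_ghost (e : E.Edge) : vertex K (E.r e) * ghost K e = ghost K e :=
  mk_eq_of_rel (.range_ghost e)

theorem ghost_mul_source (e : E.Edge) : ghost K e * vertex K (E.s e) = ghost K e :=
  mk_eq_of_rel (.ghost_source e)

theorem ghost_mul_edge_self (e : E.Edge) : ghost K e * edge K e = vertex K (E.r e) :=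
  mk_eq_of_rel (.ck1_same e)

theorem ghost_mul_edge_of_ne {e f : E.Edge} (h : e ≠ f) : ghost K e * edge K f = 0 :=
  mk_eq_of_rel (.ck1_ne e f h)

theorem mk_sum {ι : Type*} (s : Finset ι) (g : ι → LeavittFree K E) :
    mk K E (∑ i ∈ s, g i) = ∑ i ∈ s, mk K E (g i) := by
  classical
  induction s using Finset.induction_on with
  | empty => rfl
  | insert i s hi ih => rw [Finset.sum_insert hi, Finset.sum_insert hi, mk_add, ih]

theorem vertex_eq_sum {x : E.V} (h : E.IsRegular x) :
    vertex K x = ∑ e ∈ h.2.toFinset, edge K e * ghost K e := by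
  rw [vertex, mk_eq_of_rel (.ck2 x h), mk_sum]
  rfl

theorem vertex_mul_edge_of_ne {x : E.V} {e : E.Edge} (h : x ≠ E.s e) :
    vertex K x * edge K e = 0 := by
  rw [← source_mul_edge, ← mul_assoc, vertex_mul_of_ne K h, zero_mul]

theorem ghost_mul_vertex_of_ne {x : E.V} {e : E.Edge} (h : E.s e ≠ x) :
    ghost K e * vertex K x = 0 := by
  rw [← ghost_mul_source, mul_assoc, vertex_mul_of_ne K h, mul_zero]

variable {K}

/-- The Leavitt path algebra is generated by vertices, edges and ghost edges. -/
theorem induction_on {P : LeavittPathAlgebra K E → Prop} (a : LeavittPathAlgebra K E)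
    (hv : ∀ x, P (vertex K x)) (he : ∀ e, P (edge K e)) (hg : ∀ e, P (ghost K e))
    (zero : P 0) (add : ∀ a b, P a → P b → P (a + b)) (smul : ∀ (k : K) a, P a → P (k • a))
    (mul : ∀ a b, P a → P b → P (a * b)) : P a := by
  have gen : ∀ x : LeavittGen E, P (mk K E (LeavittFree.gen K x)) := by
    rintro (x | e | e)
    exacts [hv x, he e, hg e]
  have word : ∀ m : FreeSemigroup (LeavittGen E), P (mk K E (MonoidAlgebra.single m 1)) := by
    intro m
    induction m using FreeSemigroup.recOnMul with
    | ih1 x => exact gen x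
    | ih2 x y hx hy =>
      have := mul _ _ hx hy
      rwa [← mk_mul, MonoidAlgebra.single_mul_single, one_mul] at this
  have single : ∀ (m : FreeSemigroup (LeavittGen E)) (k : K),
      P (mk K E (MonoidAlgebra.single m k)) := by
    intro m k
    have := smul k _ (word m)
    rwa [← mk_smul, MonoidAlgebra.smul_single, smul_eq_mul, mul_one] at this
  obtain ⟨a, rfl⟩ := mk_surjective K E a
  induction a using MonoidAlgebra.induction with
  | zero => exact zero
  | single_add m r x _ _ hx => exact add _ _ (single m r) hx

/-- Every element is the sum of its right corners, over any large enough finite set of vertices. -/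
theorem exists_sum_mul_vertex (a : LeavittPathAlgebra K E) :
    ∃ T : Finset E.V, ∀ T', T ⊆ T' → ∑ x ∈ T', a * vertex K x = a := by
  classical
  have key : ∀ (b : LeavittPathAlgebra K E) (y : E.V), b * vertex K y = b →
      ∃ T : Finset E.V, ∀ T', T ⊆ T' → ∑ x ∈ T', b * vertex K x = b := by
    intro b y hb
    refine ⟨{y}, fun T' hT => ?_⟩
    rw [Finset.sum_eq_single y, hb]
    · intro x _ hx
      rw [← hb, mul_assoc, vertex_mul_of_ne K hx.symm, mul_zero]
    · exact fun h => (h (hT (Finset.mem_singleton_self y))).elim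
  induction a using induction_on with
  | hv x => exact key _ x (vertex_mul_self K x)
  | he e => exact key _ (E.r e) (edge_mul_range K e)
  | hg e => exact key _ (E.s e) (ghost_mul_source K e)
  | zero => exact ⟨∅, fun _ _ => by simp⟩
  | add a b ha hb =>
    obtain ⟨S, hS⟩ := ha
    obtain ⟨T, hT⟩ := hb
    -- Both summands must be recovered over one set of vertices, which is why the claim covers every
    -- larger set.
    refine ⟨S ∪ T, fun U hU => ?_⟩
    simp only [add_mul, Finset.sum_add_distrib]
    rw [hS U (Finset.union_subset_left hU), hT U (Finset.union_subset_right hU)]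
  | smul k a ha =>
    obtain ⟨S, hS⟩ := ha
    refine ⟨S, fun U hU => ?_⟩
    simp only [smul_mul_assoc]
    rw [← Finset.smul_sum, hS U hU]
  | mul a b _ hb =>
    obtain ⟨T, hT⟩ := hb
    refine ⟨T, fun U hU => ?_⟩
    simp only [mul_assoc]
    rw [← Finset.mul_sum, hT U hU]

/-! ### Paths and the filtration by ghost length -/

variable (K) in
/-- The element given by a list of edges followed by the vertex `w`; it vanishes unless the
edges form a path ending in `w`. -/
noncomputable def pathTo (w : E.V) : List E.Edge → LeavittPathAlgebra K E
  | [] => vertex K w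
  | e :: l => edge K e * pathTo w l

theorem pathTo_mul_vertex (w : E.V) (l : List E.Edge) :
    pathTo K w l * vertex K w = pathTo K w l := by
  induction l with
  | nil => exact vertex_mul_self K w
  | cons e l ih => rw [pathTo, mul_assoc, ih]

theorem pathTo_mul_edge (e : E.Edge) (l : List E.Edge) :
    pathTo K (E.s e) l * edge K e = pathTo K (E.r e) (l ++ [e]) := by
  induction l with
  | nil => rw [List.nil_append, pathTo, pathTo, pathTo, source_mul_edge, edge_mul_range]
  | cons f l ih => rw [pathTo, mul_assoc, ih, List.cons_append, pathTo]

variable (K) in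
/-- The span of the paths ending in `w`. -/
noncomputable def pathsTo (w : E.V) : Submodule K (LeavittPathAlgebra K E) :=
  Submodule.span K (Set.range (pathTo K w))

theorem pathTo_mem (w : E.V) (l : List E.Edge) : pathTo K w l ∈ pathsTo K w :=
  Submodule.subset_span ⟨l, rfl⟩

variable (K E) in
/-- The span of the products `p * q*` of a path and a ghost path of length at most `n`. -/
noncomputable def ghostFiltration : ℕ → Submodule K (LeavittPathAlgebra K E)
  | 0 => ⨆ w, pathsTo K w
  | n + 1 => ghostFiltration n ⊔
      ⨆ e, (ghostFiltration n).map (LinearMap.mulRight K (ghost K e))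

theorem mul_ghost_mem {n : ℕ} {a : LeavittPathAlgebra K E} (ha : a ∈ ghostFiltration K E n)
    (e : E.Edge) : a * ghost K e ∈ ghostFiltration K E (n + 1) :=
  Submodule.mem_sup_right (Submodule.mem_iSup_of_mem e ⟨a, ha, rfl⟩)

theorem ghostFiltration_mono : Monotone (ghostFiltration K E) :=
  monotone_nat_of_le_succ fun _ => le_sup_left

theorem pathsTo_le_ghostFiltration (w : E.V) (n : ℕ) : pathsTo K w ≤ ghostFiltration K E n :=
  (le_iSup (pathsTo K) w).trans (ghostFiltration_mono (Nat.zero_le n))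

/-- Induction over the filtration by ghost length. -/
theorem ghostFiltration_induction {P : ℕ → LeavittPathAlgebra K E → Prop}
    (path : ∀ w l, P 0 (pathTo K w l))
    (succ : ∀ n, ∀ a ∈ ghostFiltration K E n, P n a → P (n + 1) a)
    (ghost : ∀ n, ∀ a ∈ ghostFiltration K E n, P n a → ∀ e, P (n + 1) (a * ghost K e))
    (zero : ∀ n, P n 0) (add : ∀ n a b, P n a → P n b → P n (a + b))
    (smul : ∀ n (k : K) a, P n a → P n (k • a)) {n : ℕ} {a : LeavittPathAlgebra K E}
    (ha : a ∈ ghostFiltration K E n) : P n a := by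
  induction n generalizing a with
  | zero =>
    rw [ghostFiltration] at ha
    induction ha using Submodule.iSup_induction' with
    | mem w a ha =>
      induction ha using Submodule.span_induction with
      | mem a ha => obtain ⟨l, rfl⟩ := ha; exact path w l
      | zero => exact zero 0
      | add a b _ _ ha hb => exact add 0 a b ha hb
      | smul k a _ ha => exact smul 0 k a ha
    | zero => exact zero 0
    | add a b _ _ ha hb => exact add 0 a b ha hb
  | succ n ih =>
    rw [ghostFiltration] at ha
    obtain ⟨b, hb, c, hc, rfl⟩ := Submodule.mem_sup.1 ha
    refine add _ _ _ (succ n b hb (ih hb)) ?_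
    clear ha
    induction hc using Submodule.iSup_induction' with
    | mem e a ha =>
      obtain ⟨a, ha, rfl⟩ := ha
      exact ghost n a ha (ih ha) e
    | zero => exact zero _
    | add a b _ _ ha hb => exact add _ a b ha hb

theorem mul_vertex_mem {n : ℕ} {a : LeavittPathAlgebra K E} (ha : a ∈ ghostFiltration K E n)
    (x : E.V) : a * vertex K x ∈ ghostFiltration K E n := by
  refine ghostFiltration_induction (P := fun n a => a * vertex K x ∈ ghostFiltration K E n)
    ?_ ?_ ?_ ?_ ?_ ?_ ha
  · intro w l
    by_cases h : w = x
    · rw [h, pathTo_mul_vertex]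
      exact pathsTo_le_ghostFiltration x 0 (pathTo_mem x l)
    · rw [← pathTo_mul_vertex, mul_assoc, vertex_mul_of_ne K h, mul_zero]
      exact zero_mem _
  · exact fun n a _ h => ghostFiltration_mono n.le_succ h
  · intro n a ha _ e
    rw [mul_assoc]
    by_cases h : E.s e = x
    · rw [← h, ghost_mul_source]
      exact mul_ghost_mem ha e
    · rw [ghost_mul_vertex_of_ne K h, mul_zero]
      exact zero_mem _
  · intro n
    rw [zero_mul]
    exact zero_mem _
  · intro n a b ha hb
    rw [add_mul]
    exact add_mem ha hb
  · intro n k a ha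
    rw [smul_mul_assoc]
    exact Submodule.smul_mem _ k ha

/-- Multiplication by an edge on the right lowers the ghost length. -/
theorem mul_edge_mem_pred {n : ℕ} {a : LeavittPathAlgebra K E} (ha : a ∈ ghostFiltration K E n)
    (e : E.Edge) : a * edge K e ∈ ghostFiltration K E (n - 1) := by
  refine ghostFiltration_induction (P := fun n a => a * edge K e ∈ ghostFiltration K E (n - 1))
    ?_ ?_ ?_ ?_ ?_ ?_ ha
  -- The truncated subtraction 0 - 1 = 0 is harmless: an edge lengthens a path and creates no ghost
  -- edge.
  · intro w l
    by_cases h : w = E.s e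
    · rw [h, pathTo_mul_edge]
      exact pathsTo_le_ghostFiltration _ _ (pathTo_mem _ _)
    · rw [← pathTo_mul_vertex, mul_assoc, vertex_mul_edge_of_ne K h, mul_zero]
      exact zero_mem _
  · exact fun n a _ h => ghostFiltration_mono (Nat.sub_le n 1) h
  · intro n a ha _ f
    rw [mul_assoc, Nat.add_sub_cancel]
    by_cases h : f = e
    · rw [h, ghost_mul_edge_self]
      exact mul_vertex_mem ha _
    · rw [ghost_mul_edge_of_ne K h, mul_zero]
      exact zero_mem _
  · intro n
    rw [zero_mul]
    exact zero_mem _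
  · intro n a b ha hb
    rw [add_mul]
    exact add_mem ha hb
  · intro n k a ha
    rw [smul_mul_assoc]
    exact Submodule.smul_mem _ k ha

/-- Right multiplication by a vertex, an edge or a ghost edge moves the level by at most one, so the
union of the filtration is a right ideal. It contains the vertices, hence also e = s(e)e and e* =
r(e)e*. -/
theorem exists_mem_ghostFiltration (a : LeavittPathAlgebra K E) :
    ∃ n, a ∈ ghostFiltration K E n := by
  have mul : ∀ a b : LeavittPathAlgebra K E, (∃ n, a ∈ ghostFiltration K E n) →
      ∃ n, a * b ∈ ghostFiltration K E n := by
    intro a b ha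
    induction b using induction_on generalizing a with
    | hv x => exact ha.imp fun n h => mul_vertex_mem h x
    | he e => exact ha.elim fun n h => ⟨n - 1, mul_edge_mem_pred h e⟩
    | hg e => exact ha.elim fun n h => ⟨n + 1, mul_ghost_mem h e⟩
    | zero => exact ⟨0, by rw [mul_zero]; exact zero_mem _⟩
    | add b c hb hc =>
      obtain ⟨m, hm⟩ := hb a ha
      obtain ⟨n, hn⟩ := hc a ha
      refine ⟨max m n, ?_⟩
      rw [mul_add]
      exact add_mem (ghostFiltration_mono (le_max_left m n) hm)
        (ghostFiltration_mono (le_max_right m n) hn)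
    | smul k b hb =>
      refine (hb a ha).imp fun n h => ?_
      rw [mul_smul_comm]
      exact Submodule.smul_mem _ k h
    | mul b c hb hc =>
      rw [← mul_assoc]
      exact hc _ (hb a ha)
  have vert : ∀ x, vertex K x ∈ ghostFiltration K E 0 := fun x =>
    pathsTo_le_ghostFiltration x 0 (pathTo_mem x [])
  induction a using induction_on with
  | hv x => exact ⟨0, vert x⟩
  | he e => exact source_mul_edge K e ▸ mul _ _ ⟨0, vert _⟩
  | hg e => exact range_mul_ghost K e ▸ mul _ _ ⟨0, vert _⟩
  | zero => exact ⟨0, zero_mem _⟩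
  | add a b ha hb =>
    obtain ⟨m, hm⟩ := ha
    obtain ⟨n, hn⟩ := hb
    exact ⟨max m n, add_mem (ghostFiltration_mono (le_max_left m n) hm)
      (ghostFiltration_mono (le_max_right m n) hn)⟩
  | smul k a ha => exact ha.imp fun n h => Submodule.smul_mem _ k h
  | mul a b ha _ => exact mul a b ha

/-! ### Corners of the algebra -/

/-- The right corner at `x` of a combination of paths. -/
theorem mul_vertex_mem_pathsTo {a : LeavittPathAlgebra K E} (ha : a ∈ ghostFiltration K E 0)
    (x : E.V) : a * vertex K x ∈ pathsTo K x := by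
  -- The level is made a variable with the equation n = 0 kept in the motive, so that the cases of
  -- positive level are vacuous.
  have : ∀ n, ∀ a ∈ ghostFiltration K E n, n = 0 → a * vertex K x ∈ pathsTo K x := by
    intro n a ha
    refine ghostFiltration_induction (P := fun n a => n = 0 → a * vertex K x ∈ pathsTo K x)
      ?_ ?_ ?_ ?_ ?_ ?_ ha
    · intro w l _
      by_cases h : w = x
      · rw [h, pathTo_mul_vertex]
        exact pathTo_mem x l
      · rw [← pathTo_mul_vertex, mul_assoc, vertex_mul_of_ne K h, mul_zero]
        exact zero_mem _
    · exact fun n a _ _ h => (n.succ_ne_zero h).elim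
    · exact fun n a _ _ e h => (n.succ_ne_zero h).elim
    · intro n _
      rw [zero_mul]
      exact zero_mem _
    · intro n a b ha hb h
      rw [add_mul]
      exact add_mem (ha h) (hb h)
    · intro n k a ha h
      rw [smul_mul_assoc]
      exact Submodule.smul_mem _ k (ha h)
  exact this 0 a ha rfl

/-- The right corner at a sink consists of combinations of paths. -/
theorem mul_vertex_mem_pathsTo_of_sink {x : E.V} (hx : ∀ e, E.s e ≠ x)
    (a : LeavittPathAlgebra K E) : a * vertex K x ∈ pathsTo K x := by
  obtain ⟨n, ha⟩ := exists_mem_ghostFiltration a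
  refine ghostFiltration_induction (P := fun _ a => a * vertex K x ∈ pathsTo K x)
    ?_ ?_ ?_ ?_ ?_ ?_ ha
  · exact fun w l =>
      mul_vertex_mem_pathsTo (pathsTo_le_ghostFiltration w 0 (pathTo_mem w l)) x
  · exact fun n a _ h => h
  · intro n a _ _ e
    rw [mul_assoc, ghost_mul_vertex_of_ne K (hx e), mul_zero]
    exact zero_mem _
  · intro n
    rw [zero_mul]
    exact zero_mem _
  · intro n a b ha hb
    rw [add_mul]
    exact add_mem ha hb
  · intro n k a ha
    rw [smul_mul_assoc]
    exact Submodule.smul_mem _ k ha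

/-- The corner between two vertices without common descendants vanishes. -/
theorem vertex_mul_mul_vertex_eq_zero {x y : E.V}
    (h : ∀ z, E.Connects x z → ¬ E.Connects y z) (a : LeavittPathAlgebra K E) :
    vertex K x * a * vertex K y = 0 := by
  -- The start x varies, because removing the first edge e replaces it by r(e).
  have path : ∀ (w : E.V) (l : List E.Edge) (x : E.V), ¬ E.Connects x w →
      vertex K x * pathTo K w l = 0 := by
    intro w l
    induction l with
    | nil =>
      intro x hx
      exact vertex_mul_of_ne K fun h => hx (h ▸ Relation.ReflTransGen.refl)
    | cons e l ih =>
      intro x hx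
      rw [pathTo, ← mul_assoc]
      by_cases hxe : x = E.s e
      · subst hxe
        rw [source_mul_edge, ← edge_mul_range, mul_assoc,
          ih _ fun h => hx (Relation.ReflTransGen.head ⟨e, rfl, rfl⟩ h), mul_zero]
      · rw [vertex_mul_edge_of_ne K hxe, zero_mul]
  obtain ⟨n, ha⟩ := exists_mem_ghostFiltration a
  -- The vertex y varies too: a final ghost edge e* turns the corner at s(e) into one at r(e), whose
  -- descendants are among those of s(e).
  refine ghostFiltration_induction (P := fun _ a => ∀ y, (∀ z, E.Connects x z →
    ¬ E.Connects y z) → vertex K x * a * vertex K y = 0) ?_ ?_ ?_ ?_ ?_ ?_ ha y h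
  · intro w l y hy
    by_cases hw : w = y
    · rw [path w l x fun h => hy w h (hw ▸ Relation.ReflTransGen.refl), zero_mul]
    · rw [← pathTo_mul_vertex, mul_assoc, mul_assoc, vertex_mul_of_ne K hw, mul_zero, mul_zero]
  · exact fun n a _ h => h
  · intro n a _ ih e y hy
    by_cases hs : E.s e = y
    · subst hs
      rw [mul_assoc, mul_assoc, ghost_mul_source, ← range_mul_ghost, ← mul_assoc, ← mul_assoc,
        mul_assoc (vertex K x), ← mul_assoc (vertex K x), 
        ih (E.r e) fun z hz hez => hy z hz (Relation.ReflTransGen.head ⟨e, rfl, rfl⟩ hez),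
        zero_mul]
    · rw [mul_assoc, mul_assoc, ghost_mul_vertex_of_ne K hs, mul_zero, mul_zero]
  · intro n y _
    rw [mul_zero, zero_mul]
  · intro n a b ha hb y hy
    rw [mul_add, add_mul, ha y hy, hb y hy, add_zero]
  · intro n k a ha y hy
    rw [mul_smul_comm, smul_mul_assoc, ha y hy, smul_zero]

end LeavittPathAlgebra

/-! ### Representations from branching systems -/

namespace LeavittPathAlgebra

open DirectedGraph Finsupp

variable {K : Type w} [Field K] {E : DirectedGraph.{u, v}}

/-- The homomorphism out of the Leavitt path algebra induced by a homomorphism out of the free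
algebra which respects the defining relations. -/
noncomputable def lift {A : Type*} [NonUnitalNonAssocSemiring A] [DistribMulAction K A]
    (F : LeavittFree K E →ₙₐ[K] A) (h : ∀ a b, LeavittRel K E a b → F a = F b) :
    LeavittPathAlgebra K E →ₙₐ[K] A :=
  have h' : ∀ a b, leavittCon K E a b → F a = F b := by
    intro a b hab
    change RingConGen.Rel (LeavittRel K E) a b at hab
    induction hab with
    | of a b hab => exact h a b hab
    | refl a => rfl
    | symm _ ih => exact ih.symm
    | trans _ _ ih₁ ih₂ => exact ih₁.trans ih₂
    | add _ _ ih₁ ih₂ => rw [map_add, map_add, ih₁, ih₂]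
    | mul _ _ ih₁ ih₂ => rw [map_mul, map_mul, ih₁, ih₂]
  { toFun := fun a => Quotient.liftOn' a F h'
    map_smul' := fun k a => by
      obtain ⟨a, rfl⟩ := mk_surjective K E a
      exact map_smul F k a
    map_zero' := map_zero F
    map_add' := fun a b => by
      obtain ⟨a, rfl⟩ := mk_surjective K E a
      obtain ⟨b, rfl⟩ := mk_surjective K E b
      exact map_add F a b
    map_mul' := fun a b => by
      obtain ⟨a, rfl⟩ := mk_surjective K E a
      obtain ⟨b, rfl⟩ := mk_surjective K E b
      exact map_mul F a b }

variable (K E) in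
/-- The space with basis the points `(x, m)` over the vertices `x`, in every integer degree. -/
abbrev BranchingSpace : Type (max u w) := (E.V × ℕ) × ℤ →₀ K

section Operators

variable (K) (φ : E.Edge → ℕ → ℕ)

open scoped Classical in
/-- The projection onto the points over a vertex. -/
noncomputable def vertexOp (x : E.V) : Module.End K (BranchingSpace K E) :=
  linearCombination K fun b => if b.1.1 = x then single b 1 else 0

open scoped Classical in
/-- An edge `e` moves the points over its range into its source, along `φ e`. -/
noncomputable def edgeOp (e : E.Edge) : Module.End K (BranchingSpace K E) :=
  linearCombination K fun b =>
    if b.1.1 = E.r e then single ((E.s e, φ e b.1.2), b.2 + 1) 1 else 0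

open scoped Classical in
/-- A ghost edge `e*` undoes `e`. -/
noncomputable def ghostOp (e : E.Edge) : Module.End K (BranchingSpace K E) :=
  linearCombination K fun b =>
    if h : b.1.1 = E.s e ∧ ∃ n, φ e n = b.1.2 then single ((E.r e, h.2.choose), b.2 - 1) 1 else 0

theorem vertexOp_self (x : E.V) (n : ℕ) (k : ℤ) :
    vertexOp K x (single ((x, n), k) 1) = single ((x, n), k) 1 := by
  simp [vertexOp]

theorem vertexOp_of_ne {x y : E.V} (h : y ≠ x) (n : ℕ) (k : ℤ) :
    vertexOp K x (single ((y, n), k) 1) = 0 := by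
  simp [vertexOp, h]

theorem edgeOp_range (e : E.Edge) (n : ℕ) (k : ℤ) :
    edgeOp K φ e (single ((E.r e, n), k) 1) = single ((E.s e, φ e n), k + 1) 1 := by
  simp [edgeOp]

theorem edgeOp_of_ne {e : E.Edge} {y : E.V} (h : y ≠ E.r e) (n : ℕ) (k : ℤ) :
    edgeOp K φ e (single ((y, n), k) 1) = 0 := by
  simp [edgeOp, h]

theorem ghostOp_of_ne {e : E.Edge} {y : E.V} (h : y ≠ E.s e) (n : ℕ) (k : ℤ) :
    ghostOp K φ e (single ((y, n), k) 1) = 0 := by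
  simp [ghostOp, h]

theorem ghostOp_of_not_mem {e : E.Edge} {y : E.V} {m : ℕ} (h : ∀ n, φ e n ≠ m) (k : ℤ) :
    ghostOp K φ e (single ((y, m), k) 1) = 0 := by
  simp [ghostOp, h]

theorem ghostOp_source {e : E.Edge} (h : Function.Injective (φ e)) (n : ℕ) (k : ℤ) :
    ghostOp K φ e (single ((E.s e, φ e n), k) 1) = single ((E.r e, n), k - 1) 1 := by
  have hn : E.s e = E.s e ∧ ∃ m, φ e m = φ e n := ⟨rfl, n, rfl⟩
  rw [ghostOp, linearCombination_single, one_smul, dif_pos hn, h hn.2.choose_spec]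

/-- The action of the generators. -/
noncomputable def genOp : LeavittGen E → Module.End K (BranchingSpace K E)
  | .vertex x => vertexOp K x
  | .edge e => edgeOp K φ e
  | .ghost e => ghostOp K φ e

/-- The action of the free algebra. -/
noncomputable def freeRep : LeavittFree K E →ₙₐ[K] Module.End K (BranchingSpace K E) :=
  MonoidAlgebra.liftMagma K (FreeSemigroup.lift (genOp K φ))

theorem freeRep_gen (x : LeavittGen E) : freeRep K φ (LeavittFree.gen K x) = genOp K φ x := by
  rw [freeRep, LeavittFree.gen, MonoidAlgebra.liftMagma_apply_apply]
  simp

end Operators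

/-- A system of maps on the points with the branching property: the images of the edges out
of a vertex partition the points over that vertex. -/
structure IsBranching (φ : E.Edge → ℕ → ℕ) : Prop where
  inj : ∀ e f m n, E.s e = E.s f → φ e m = φ f n → e = f ∧ m = n
  surj : ∀ e m, ∃ f n, E.s f = E.s e ∧ φ f n = m

/-- Over a vertex emitting a finite nonempty set of edges, the disjoint union of one copy of ℕ per
edge is countably infinite, hence in bijection with ℕ. -/
theorem _root_.DirectedGraph.RowFinite.exists_isBranching (hE : E.RowFinite) :
    ∃ φ : E.Edge → ℕ → ℕ, IsBranching φ := by
  have key : ∀ x : E.V, ∃ ψ : {e : E.Edge // E.s e = x} × ℕ → ℕ, Function.Injective ψ ∧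
      (Nonempty {e : E.Edge // E.s e = x} → Function.Surjective ψ) := by
    intro x
    have : Finite {e : E.Edge // E.s e = x} := hE x
    cases isEmpty_or_nonempty {e : E.Edge // E.s e = x} with
    | inl h =>
      -- At a sink the domain is empty, so any map will do, and surjectivity is not demanded.
      exact ⟨fun _ => 0, fun a => (h.false a.1).elim, fun h' => (not_nonempty_iff.2 h h').elim⟩
    | inr h =>
      obtain ⟨ψ⟩ := nonempty_equiv_of_countable (α := {e : E.Edge // E.s e = x} × ℕ) (β := ℕ)
      exact ⟨ψ, ψ.injective, fun _ => ψ.surjective⟩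
  choose ψ hinj hsurj using key
  refine ⟨fun e n => ψ (E.s e) (⟨e, rfl⟩, n), ?_, ?_⟩
  · have aux : ∀ x y e f m n (he : E.s e = x) (hf : E.s f = y), x = y →
        ψ x (⟨e, he⟩, m) = ψ y (⟨f, hf⟩, n) → e = f ∧ m = n := by
      rintro x _ e f m n he hf rfl h
      simpa using hinj x h
    exact fun e f m n hs h => aux _ _ e f m n rfl rfl hs h
  · intro e m
    obtain ⟨⟨⟨f, hf⟩, n⟩, h⟩ := hsurj (E.s e) ⟨⟨e, rfl⟩⟩ m
    refine ⟨f, n, hf, ?_⟩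
    have aux : ∀ x (hx : E.s f = x), ψ x (⟨f, hx⟩, n) = ψ (E.s f) (⟨f, rfl⟩, n) := by
      rintro _ rfl
      rfl
    rw [← aux _ hf, h]

variable {φ : E.Edge → ℕ → ℕ}

theorem IsBranching.injective (hφ : IsBranching φ) (e : E.Edge) : Function.Injective (φ e) :=
  fun m n h => (hφ.inj e e m n rfl h).2

theorem end_ext {f g : Module.End K (BranchingSpace K E)}
    (h : ∀ x m k, f (single ((x, m), k) 1) = g (single ((x, m), k) 1)) : f = g := by
  refine Finsupp.lhom_ext' fun b => LinearMap.ext_ring ?_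
  exact h b.1.1 b.1.2 b.2

/-- The first Cuntz-Krieger relation holds because each map `φ e` is injective and edges with the
same source have disjoint images; the second because these images cover the points over a regular
vertex. -/
theorem freeRep_rel (hφ : IsBranching φ) (a b : LeavittFree K E) (h : LeavittRel K E a b) :
    freeRep K φ a = freeRep K φ b := by
  have hv : ∀ x, freeRep K φ (LeavittFree.vtx K x) = vertexOp K x := fun x => freeRep_gen K φ _
  have he : ∀ x, freeRep K φ (LeavittFree.edg K x) = edgeOp K φ x := fun x => freeRep_gen K φ _
  have hg : ∀ x, freeRep K φ (LeavittFree.gst K x) = ghostOp K φ x := fun x => freeRep_gen K φ _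
  induction h with
  | vertex_idem x =>
    rw [map_mul, hv]
    refine end_ext fun y m k => ?_
    rw [Module.End.mul_apply]
    by_cases h : y = x
    · subst h; rw [vertexOp_self, vertexOp_self]
    · rw [vertexOp_of_ne K h, map_zero]
  | vertex_orth x z hxz =>
    rw [map_mul, hv, hv, map_zero]
    refine end_ext fun y m k => ?_
    rw [Module.End.mul_apply]
    by_cases h : y = z
    · subst h; rw [vertexOp_self, vertexOp_of_ne K hxz.symm, LinearMap.zero_apply]
    · rw [vertexOp_of_ne K h, map_zero, LinearMap.zero_apply]
  | source_edge e =>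
    rw [map_mul, hv, he]
    refine end_ext fun y m k => ?_
    rw [Module.End.mul_apply]
    by_cases h : y = E.r e
    · subst h; rw [edgeOp_range, vertexOp_self]
    · rw [edgeOp_of_ne K φ h, map_zero]
  | edge_range e =>
    rw [map_mul, hv, he]
    refine end_ext fun y m k => ?_
    rw [Module.End.mul_apply]
    by_cases h : y = E.r e
    · subst h; rw [vertexOp_self]
    · rw [edgeOp_of_ne K φ h, vertexOp_of_ne K h, map_zero]
  | range_ghost e =>
    rw [map_mul, hv, hg]
    refine end_ext fun y m k => ?_
    rw [Module.End.mul_apply]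
    by_cases h : y = E.s e
    · subst h
      by_cases hm : ∃ n, φ e n = m
      · obtain ⟨n, rfl⟩ := hm
        rw [ghostOp_source K φ (hφ.injective e), vertexOp_self]
      · rw [ghostOp_of_not_mem K φ (not_exists.1 hm), map_zero]
    · rw [ghostOp_of_ne K φ h, map_zero]
  | ghost_source e =>
    rw [map_mul, hv, hg]
    refine end_ext fun y m k => ?_
    rw [Module.End.mul_apply]
    by_cases h : y = E.s e
    · subst h; rw [vertexOp_self]
    · rw [ghostOp_of_ne K φ h, vertexOp_of_ne K h, map_zero]
  | ck1_same e =>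
    rw [map_mul, hv, hg, he]
    refine end_ext fun y m k => ?_
    rw [Module.End.mul_apply]
    by_cases h : y = E.r e
    · subst h
      rw [edgeOp_range, ghostOp_source K φ (hφ.injective e), vertexOp_self, add_sub_cancel_right]
    · rw [edgeOp_of_ne K φ h, vertexOp_of_ne K h, map_zero]
  | ck1_ne e f hef =>
    rw [map_mul, hg, he, map_zero]
    refine end_ext fun y m k => ?_
    rw [Module.End.mul_apply, LinearMap.zero_apply]
    by_cases h : y = E.r f
    · subst h
      rw [edgeOp_range]
      by_cases hs : E.s f = E.s e
      · exact ghostOp_of_not_mem K φ (fun n hn => hef (hφ.inj e f n m hs.symm hn).1) _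
      · exact ghostOp_of_ne K φ hs _ _
    · rw [edgeOp_of_ne K φ h, map_zero]
  | ck2 x hx =>
    rw [hv, map_sum]
    simp only [map_mul, he, hg]
    refine end_ext fun y m k => ?_
    rw [LinearMap.sum_apply]
    by_cases h : y = x
    · subst h
      obtain ⟨e₀, rfl⟩ := hx.1
      -- The point lies in the image of exactly one edge e, so only the summand ee* acts on it, and
      -- it acts as the identity.
      obtain ⟨e, n, hs, rfl⟩ := hφ.surj e₀ m
      rw [vertexOp_self, Finset.sum_eq_single e]
      · rw [Module.End.mul_apply, ← hs, ghostOp_source K φ (hφ.injective e), edgeOp_range,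
          sub_add_cancel]
      · intro f hf hfe
        have hf' : E.s f = E.s e₀ := by simpa using hf
        rw [Module.End.mul_apply, ghostOp_of_not_mem K φ, map_zero]
        exact fun l hl => hfe (hφ.inj f e l n (hf'.trans hs.symm) hl).1
      · intro h
        exact (h (by simpa using hs)).elim
    · rw [vertexOp_of_ne K h]
      refine (Finset.sum_eq_zero fun f hf => ?_).symm
      have hf' : E.s f = x := by simpa using hf
      rw [Module.End.mul_apply, ghostOp_of_ne K φ (hf' ▸ h), map_zero]
  | smul k a b _ ih => rw [map_smul, map_smul, ih]

/-- The representation attached to a branching system. -/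
noncomputable def rep (hφ : IsBranching φ) :
    LeavittPathAlgebra K E →ₙₐ[K] Module.End K (BranchingSpace K E) :=
  lift (freeRep K φ) (freeRep_rel hφ)

theorem rep_vertex (hφ : IsBranching φ) (x : E.V) : rep hφ (vertex K x) = vertexOp K x :=
  freeRep_gen K φ _

theorem rep_edge (hφ : IsBranching φ) (e : E.Edge) : rep hφ (edge K e) = edgeOp K φ e :=
  freeRep_gen K φ _

/-! ### Paths acting on basis vectors -/

/-- The first vertex of a list of edges followed by the vertex `w`. -/
def startOf (w : E.V) : List E.Edge → E.V
  | [] => w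
  | e :: _ => E.s e

/-- The edges of the list form a path ending in `w`. -/
def IsPathTo (w : E.V) : List E.Edge → Prop
  | [] => True
  | e :: l => startOf w l = E.r e ∧ IsPathTo w l

theorem vertex_mul_pathTo_of_ne {x w : E.V} {l : List E.Edge} (h : x ≠ startOf w l) :
    vertex K x * pathTo K w l = 0 := by
  cases l with
  | nil => exact vertex_mul_of_ne K h
  | cons e l => rw [pathTo, ← mul_assoc, vertex_mul_edge_of_ne K h, zero_mul]

theorem pathTo_eq_zero {w : E.V} {l : List E.Edge} (h : ¬ IsPathTo w l) : pathTo K w l = 0 := by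
  induction l with
  | nil => exact (h trivial).elim
  | cons e l ih =>
    rw [pathTo]
    by_cases hs : startOf w l = E.r e
    · rw [ih fun hl => h ⟨hs, hl⟩, mul_zero]
    · rw [← edge_mul_range, mul_assoc, vertex_mul_pathTo_of_ne (Ne.symm hs), mul_zero]

theorem rep_pathTo (hφ : IsBranching φ) {w : E.V} {l : List E.Edge} (h : IsPathTo w l) (m : ℕ)
    (k : ℤ) : rep hφ (pathTo K w l) (single ((w, m), k) 1) =
      single ((startOf w l, l.foldr φ m), k + l.length) 1 := by
  induction l with
  | nil => rw [pathTo, rep_vertex, vertexOp_self]; simp [startOf]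
  | cons e l ih =>
    rw [pathTo, map_mul, Module.End.mul_apply, ih h.2, rep_edge, h.1, edgeOp_range]
    simp [startOf, add_assoc]

/-- The branching property recovers the first edge and the point it came from, and one recurses.
Equal length is needed because a cycle may return a point to itself; the integer degree in the
representation space supplies it. -/
theorem eq_of_startOf_eq (hφ : IsBranching φ) {w : E.V} {m : ℕ} {l l' : List E.Edge}
    (hs : startOf w l = startOf w l')
    (hm : l.foldr φ m = l'.foldr φ m) (hlen : l.length = l'.length)
    (hl : IsPathTo w l) (hl' : IsPathTo w l') : l = l' := by
  induction l generalizing l' with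
  | nil => exact (List.length_eq_zero_iff.1 hlen.symm).symm
  | cons e l ih =>
    cases l' with
    | nil => simp at hlen
    | cons e' l' =>
      obtain ⟨rfl, h⟩ := hφ.inj e e' _ _ hs hm
      rw [ih (hl.1.trans hl'.1.symm) h (by simpa using hlen) hl.2 hl'.2]

/-- A combination of paths ending in `w` which kills a basis vector over `w` is zero. -/
theorem eq_zero_of_rep_eq_zero (hφ : IsBranching φ) {w : E.V} {a : LeavittPathAlgebra K E}
    (ha : a ∈ pathsTo K w) {m : ℕ} {k : ℤ} (h : rep hφ a (single ((w, m), k) 1) = 0) : a = 0 := by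
  classical
  obtain ⟨c, rfl⟩ := mem_span_range_iff_exists_finsupp.1 ha
  refine Finset.sum_eq_zero fun l hl => ?_
  change c l • pathTo K w l = 0
  by_cases hp : IsPathTo w l
  -- The coordinate at the image of the path l equals its coefficient: other paths have other
  -- images, and lists that are not paths give the zero element.
  · have hc := DFunLike.congr_fun h ((startOf w l, l.foldr φ m), k + l.length)
    rw [Finsupp.sum, map_sum, LinearMap.sum_apply, Finsupp.finsetSum_apply,
      Finset.sum_eq_single l] at hc
    · rw [map_smul, LinearMap.smul_apply, rep_pathTo hφ hp] at hc
      have : c l = 0 := by simpa using hc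
      rw [this, zero_smul]
    · intro l' _ hne
      rw [map_smul, LinearMap.smul_apply]
      by_cases hp' : IsPathTo w l'
      · rw [rep_pathTo hφ hp', Finsupp.smul_apply, Finsupp.single_apply, if_neg, smul_zero]
        intro heq
        simp only [Prod.mk.injEq, add_right_inj, Nat.cast_inj] at heq
        exact hne (eq_of_startOf_eq hφ heq.1.1 heq.1.2 heq.2 hp' hp)
      · rw [pathTo_eq_zero hp', map_zero, LinearMap.zero_apply, smul_zero, Finsupp.zero_apply]
    · exact fun h => (h hl).elim
  · rw [pathTo_eq_zero hp, smul_zero]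

/-- Along a path from `x` to `y`, basis vectors over `y` move to basis vectors over `x`. -/
theorem exists_rep_of_connects (hφ : IsBranching φ) {x y : E.V} (h : E.Connects x y) :
    ∃ q : LeavittPathAlgebra K E, ∃ m k, rep hφ (q * vertex K y) (single ((y, 0), 0) 1) =
      single ((x, m), k) 1 := by
  induction h using Relation.ReflTransGen.head_induction_on with
  | refl =>
    refine ⟨vertex K y, 0, 0, ?_⟩
    rw [vertex_mul_self, rep_vertex, vertexOp_self]
  | head h' _ ih =>
    obtain ⟨e, rfl, rfl⟩ := h'
    obtain ⟨q, m, k, hq⟩ := ih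
    refine ⟨edge K e * q, φ e m, k + 1, ?_⟩
    rw [mul_assoc, map_mul, Module.End.mul_apply, hq, rep_edge, edgeOp_range]

end LeavittPathAlgebra

/-! ### Annihilators of ideals generated by vertices -/

namespace LeavittPathAlgebra

open DirectedGraph

variable {K : Type w} [Field K] {E : DirectedGraph.{u, v}}

theorem vertex_mem_vertexIdeal {A : Set E.V} {x : E.V} (hx : x ∈ A) :
    vertex K x ∈ vertexIdeal K A :=
  TwoSidedIdeal.subset_span ⟨x, hx, rfl⟩

theorem mem_vertexIdeal_of_mul_vertex_mem {I : TwoSidedIdeal (LeavittPathAlgebra K E)}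
    {a : LeavittPathAlgebra K E} (h : ∀ x, a * vertex K x ∈ I) : a ∈ I := by
  obtain ⟨T, hT⟩ := exists_sum_mul_vertex a
  rw [← hT T subset_rfl]
  exact I.finsetSum_mem T _ fun x _ => h x

theorem vertexIdeal_exterior_le_Ann {A : Set E.V} (hA : E.IsHereditary A) :
    vertexIdeal K (E.exterior A) ≤ (vertexIdeal K A).Ann := by
  refine TwoSidedIdeal.span_le.2 ?_
  rintro _ ⟨x, hx, rfl⟩
  rw [mem_exterior_iff] at hx
  -- The arbitrary middle factor makes the elements killed by x from both sides a two-sided ideal,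
  -- so only the generators y in A need checking. A common descendant of x and y would lie in A, as
  -- A is hereditary.
  let N : TwoSidedIdeal (LeavittPathAlgebra K E) :=
    TwoSidedIdeal.mk' {b | ∀ a, vertex K x * a * b = 0 ∧ b * a * vertex K x = 0}
      (fun a => by simp)
      (fun {b c} hb hc a => by
        rw [mul_add, add_mul, add_mul, (hb a).1, (hb a).2, (hc a).1, (hc a).2, add_zero]
        exact ⟨rfl, rfl⟩)
      (fun {b} hb a => by rw [mul_neg, neg_mul, neg_mul, (hb a).1, (hb a).2, neg_zero]; simp)
      (fun {b c} hc a => by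
        constructor
        · rw [← mul_assoc, mul_assoc (vertex K x), (hc _).1]
        · rw [mul_assoc, mul_assoc, ← mul_assoc c, (hc a).2, mul_zero])
      (fun {b c} hb a => by
        constructor
        · rw [← mul_assoc, (hb a).1, zero_mul]
        · rw [mul_assoc b, (hb _).2])
  have hN : vertexIdeal K A ≤ N := by
    refine TwoSidedIdeal.span_le.2 ?_
    rintro _ ⟨y, hy, rfl⟩
    refine (TwoSidedIdeal.mem_mk' ..).2 fun a => ⟨?_, ?_⟩
    · exact vertex_mul_mul_vertex_eq_zero (fun z hxz hyz => hx ⟨z, hA y hy z hyz, hxz⟩) a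
    · exact vertex_mul_mul_vertex_eq_zero (fun z hyz hxz => hx ⟨z, hA y hy z hyz, hxz⟩) a
  refine (TwoSidedIdeal.mem_Ann _ _).2 fun b hb => ?_
  -- The idempotent x itself replaces the missing unit as middle factor.
  have := (TwoSidedIdeal.mem_mk' ..).1 (hN hb) (vertex K x)
  rwa [vertex_mul_self, mul_assoc, vertex_mul_self] at this

/-- Descent on ghost length, corner by corner: sinks and level zero leave combinations of paths, and
a regular vertex is expanded by the second Cuntz-Krieger relation, which row-finiteness provides at
every vertex that emits an edge. -/
theorem Ann_vertexIdeal_le (hE : E.RowFinite) (A : Set E.V) :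
    (vertexIdeal K A).Ann ≤ vertexIdeal K (E.exterior A) := by
  obtain ⟨φ, hφ⟩ := hE.exists_isBranching
  have paths : ∀ x, ∀ a ∈ (vertexIdeal K A).Ann, a * vertex K x ∈ pathsTo K x →
      a * vertex K x ∈ vertexIdeal K (E.exterior A) := by
    intro x a ha hx
    by_cases hxA : E.ConnectsTo x A
    · obtain ⟨y, hy, hxy⟩ := hxA
      obtain ⟨q, m, k, hq⟩ := exists_rep_of_connects (K := K) hφ hxy
      -- The factor y puts the right-hand product in I(A). Applied to a basis vector over y, the
      -- equation says that ax kills a basis vector over x, which forces ax = 0.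
      have h0 : a * vertex K x * (q * vertex K y) = 0 :=
        ((TwoSidedIdeal.mem_Ann _ _).1 (TwoSidedIdeal.mul_mem_right _ a (vertex K x) ha) _
          (TwoSidedIdeal.mul_mem_left _ q _ (vertex_mem_vertexIdeal hy))).1
      have h1 := congrArg (fun b => rep hφ b (Finsupp.single ((y, 0), 0) 1)) h0
      simp only [map_zero, LinearMap.zero_apply] at h1
      rw [map_mul, Module.End.mul_apply, hq] at h1
      rw [eq_zero_of_rep_eq_zero hφ hx h1]
      exact TwoSidedIdeal.zero_mem _
    · exact TwoSidedIdeal.mul_mem_left _ _ _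
        (vertex_mem_vertexIdeal ((E.mem_exterior_iff A x).2 hxA))
  have main : ∀ n, ∀ a ∈ (vertexIdeal K A).Ann, a ∈ ghostFiltration K E n →
      a ∈ vertexIdeal K (E.exterior A) := by
    intro n
    induction n with
    | zero =>
      exact fun a ha hn => mem_vertexIdeal_of_mul_vertex_mem fun x =>
        paths x a ha (mul_vertex_mem_pathsTo hn x)
    | succ n ih =>
      refine fun a ha hn => mem_vertexIdeal_of_mul_vertex_mem fun x => ?_
      by_cases hx : ∃ e, E.s e = x
      · have hreg : E.IsRegular x := ⟨hx, hE x⟩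
        rw [vertex_eq_sum K hreg, Finset.mul_sum]
        refine TwoSidedIdeal.finsetSum_mem _ _ _ fun e _ => ?_
        rw [← mul_assoc]
        exact TwoSidedIdeal.mul_mem_right _ _ _
          (ih _ (TwoSidedIdeal.mul_mem_right _ _ _ ha) (mul_edge_mem_pred hn e))
      · exact paths x a ha (mul_vertex_mem_pathsTo_of_sink (not_exists.1 hx) a)
  intro a ha
  obtain ⟨n, hn⟩ := exists_mem_ghostFiltration a
  exact main n a ha hn

/-- In the Leavitt path algebra of a row-finite graph, the annihilator of the ideal generated by
a hereditary set of vertices is generated by the exterior of this set. -/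
theorem Ann_vertexIdeal (hE : E.RowFinite) {A : Set E.V} (hA : E.IsHereditary A) :
    (vertexIdeal K A).Ann = vertexIdeal K (E.exterior A) :=
  le_antisymm (Ann_vertexIdeal_le hE A) (vertexIdeal_exterior_le_Ann hA)

end LeavittPathAlgebra

/-! ### Transport along isomorphisms, and exteriors in the graph -/

theorem TwoSidedIdeal.image_Ann {R S : Type*} [NonUnitalRing R] [NonUnitalRing S] (f : R ≃+* S)
    {I : TwoSidedIdeal R} {J : TwoSidedIdeal S} (h : f '' (I : Set R) = (J : Set S)) :
    f '' (I.Ann : Set R) = (J.Ann : Set S) := by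
  have hI : ∀ x, f x ∈ J ↔ x ∈ I := fun x => by
    rw [← SetLike.mem_coe, ← h, f.injective.mem_set_image, SetLike.mem_coe]
  ext b
  obtain ⟨a, rfl⟩ := f.surjective b
  rw [f.injective.mem_set_image, SetLike.mem_coe, SetLike.mem_coe, mem_Ann, mem_Ann,
    f.surjective.forall]
  simp only [hI, ← map_mul, map_eq_zero_iff f f.injective]

namespace DirectedGraph

variable {E : DirectedGraph.{u, v}}

theorem isHereditary_exterior (A : Set E.V) : E.IsHereditary (E.exterior A) := by
  intro x hx y hxy
  rw [mem_exterior_iff] at hx ⊢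
  rintro ⟨z, hz, hyz⟩
  exact hx ⟨z, hz, hxy.trans hyz⟩

/-- A nontrivial path from x into A passes through some r(e) with s(e) = x. If the path is trivial,
x lies in A; regularity then provides an edge, and heredity puts its range in A. -/
theorem isSaturated_exterior {A : Set E.V} (hA : E.IsHereditary A) :
    E.IsSaturated (E.exterior A) := by
  intro x hx h
  simp only [mem_exterior_iff] at h ⊢
  rintro ⟨z, hz, hxz⟩
  rcases Relation.ReflTransGen.cases_head hxz with rfl | ⟨_, ⟨e, he, rfl⟩, hez⟩
  · obtain ⟨e, he⟩ := hx.1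
    exact h e he ⟨E.r e, hA _ hz _ (Relation.ReflTransGen.single ⟨e, he, rfl⟩),
      Relation.ReflTransGen.refl⟩
  · exact h e he ⟨z, hz, hez⟩

theorem mem_exterior_exterior_iff (A : Set E.V) (x : E.V) : x ∈ E.exterior (E.exterior A) ↔
    ∀ y, ¬ E.ConnectsTo y A → ¬ E.Connects x y := by
  rw [mem_exterior_iff, ConnectsTo, not_exists]
  simp only [mem_exterior_iff, not_and]

namespace PointFunctor

theorem hereditary_exterior (H : PointFunctor.{u, v}) : Hereditary H.exterior :=
  fun _ => isHereditary_exterior _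

theorem Hereditary.saturated_exterior {H : PointFunctor.{u, v}} (hH : Hereditary H) :
    Saturated H.exterior :=
  fun E => isSaturated_exterior (hH E)

theorem FRelated.exterior {K : Type w} [Field K] {H₁ H₂ : PointFunctor.{u, v}}
    (h₁ : Hereditary H₁) (h₂ : Hereditary H₂) {E F : DirectedGraph.{u, v}} (hE : E.RowFinite)
    (hF : F.RowFinite) {f : LeavittPathAlgebra K E ≃+* LeavittPathAlgebra K F}
    (h : FRelated f H₁ H₂) : FRelated f H₁.exterior H₂.exterior := by
  have := TwoSidedIdeal.image_Ann f h
  rwa [LeavittPathAlgebra.Ann_vertexIdeal hE (h₁ E),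
    LeavittPathAlgebra.Ann_vertexIdeal hF (h₂ F)] at this

end PointFunctor

end DirectedGraph

open DirectedGraph DirectedGraph.PointFunctor LeavittPathAlgebra in
theorem proposition3p6 (K : Type w) [Field K] :
    (∀ H : PointFunctor.{u, v}, Hereditary H → Saturated H →
      (Hereditary H.exterior ∧ Saturated H.exterior) ∧
      (∀ E : DirectedGraph.{u, v}, E.RowFinite →
        (vertexIdeal K (points H E)).Ann = vertexIdeal K (points H.exterior E)) ∧
      ((Hereditary H.exterior.exterior ∧
          Saturated H.exterior.exterior) ∧
        (∀ E : DirectedGraph.{u, v}, E.RowFinite →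
          (vertexIdeal K (points H E)).Ann.Ann =
            vertexIdeal K (points H.exterior.exterior E))) ∧
      (∀ E : DirectedGraph.{u, v},
        points H.exterior.exterior E ⊆
          {x : E.V | E.ConnectsTo x (points H E)}) ∧
      (∀ E : DirectedGraph.{u, v},
        points H E ⊆ points H.exterior.exterior E) ∧
      (∀ E : DirectedGraph.{u, v},
        points H.exterior.exterior E ⊆ points H E ↔
          ∀ x : E.V, (∀ y : E.V, ¬ E.ConnectsTo y (points H E) → ¬ E.Connects x y) →
            x ∈ points H E)) ∧
    (∀ H₁ H₂ : PointFunctor.{u, v}, Hereditary H₁ → Hereditary H₂ →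
      ∀ E F : DirectedGraph.{u, v}, E.RowFinite → F.RowFinite →
      ∀ f : LeavittPathAlgebra K E ≃+* LeavittPathAlgebra K F,
        FRelated f H₁ H₂ → FRelated f H₁.exterior H₂.exterior) ∧
    (∀ H : PointFunctor.{u, v}, Hereditary H →
      ∀ E F : DirectedGraph.{u, v}, E.RowFinite → F.RowFinite →
      ∀ f : LeavittPathAlgebra K E ≃+* LeavittPathAlgebra K F,
        FInvariant f H → FInvariant f H.exterior) := by
  refine ⟨fun H hH _ => ?_, fun H₁ H₂ h₁ h₂ E F hE hF f h => h.exterior h₁ h₂ hE hF,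
    fun H hH E F hE hF f h => FRelated.exterior hH hH hE hF h⟩
  have hH' := hereditary_exterior H
  refine ⟨⟨hH', hH.saturated_exterior⟩, fun E hE => Ann_vertexIdeal hE (hH E),
    ⟨⟨hereditary_exterior _, hH'.saturated_exterior⟩, fun E hE => ?_⟩, fun E x hx => ?_,
    fun E x hx => ?_, fun E => ?_⟩
  · rw [Ann_vertexIdeal hE (hH E)]
    -- The exterior is again hereditary, so the annihilator formula can be iterated.
    exact Ann_vertexIdeal hE (hH' E)
  · by_contra h
    -- The trivial path already leads from x to a vertex not connecting to H(E), namely x.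
    exact (mem_exterior_exterior_iff _ x).1 hx x h Relation.ReflTransGen.refl
  · exact (mem_exterior_exterior_iff _ x).2 fun y hy hxy =>
      hy ⟨y, hH E x hx y hxy, Relation.ReflTransGen.refl⟩
  · exact forall_congr' fun x => imp_congr_left (mem_exterior_exterior_iff _ x)
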